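/- All Lie algebras are finite-dimensional. Let $F \subseteq E$ be a Galois extension of finite degree. For a Lie algebra $\mathfrak g$ over $E$, let $\mathfrak g_F$ denote the underlying Lie algebra over $F$, obtained by restricting the scalar multiplication from $E$ to $F$. Then for every Lie algebra $\mathfrak h$ over $F$ there are, up to isomorphism of Lie algebras over $E$, only finitely many (possibly no) Lie algebras $\mathfrak g$ over $E$ such that $\mathfrak g_F \cong \mathfrak h$ as Lie algebras over $F$. In particular, every real Lie algebra $\mathfrak h$ admits, up to isomorphism, only finitely many bi-invariant complex structures. Here a bi-invariant complex structure on $\mathfrak h$ is an $\mathbb R$-linear map $J : \mathfrak h \to \mathfrak h$ with $J^2 = -\mathrm{id}$ and $[JX, Y] = J[X,Y]$ for all $X, Y \in \mathfrak h$ (equivalently, a complex Lie algebra structure on $\mathfrak h$ whose underlying real Lie algebra is $\mathfrak h$), and $J_1, J_2$ are isomorphic if there is an automorphism $\varphi$ of the real Lie algebra $\mathfrak h$ with $\varphi \circ J_1 = J_2 \circ \varphi$. -/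

import Mathlib

universe u v w x y

/-- A Lie algebra over the field `E` (in characteristic two, `⁅X, X⁆ = 0` is part of `LieRing`),
bundled so that one can speak of the collection of all Lie algebras over `E`. -/
structure BundledLieAlgebra (E : Type v) [Field E] where
  carrier : Type x
  [lieRing : LieRing carrier]
  [lieAlgebra : LieAlgebra E carrier]

namespace BundledLieAlgebra

attribute [instance] lieRing lieAlgebra

/-- Isomorphism of Lie algebras over `E`, as an equivalence relation. -/
def isoSetoid (E : Type v) [Field E] : Setoid (BundledLieAlgebra.{v, x} E) where
  r g g' := Nonempty (g.carrier ≃ₗ⁅E⁆ g'.carrier)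
  iseqv :=
    { refl := fun _ => ⟨LieEquiv.refl⟩
      symm := fun ⟨e⟩ => ⟨e.symm⟩
      trans := fun ⟨e⟩ ⟨e'⟩ => ⟨e.trans e'⟩ }

/-- The isomorphism classes of Lie algebras over `E`. -/
abbrev IsoClass (E : Type v) [Field E] : Type (max v (x + 1)) :=
  Quotient (isoSetoid.{v, x} E)

/-- The isomorphism class of a Lie algebra over `E`. -/
def isoClass {E : Type v} [Field E] (g : BundledLieAlgebra.{v, x} E) : IsoClass.{v, x} E :=
  Quotient.mk (isoSetoid E) g

/-- The underlying Lie algebra over `F` of the Lie algebra `g` over `E`: the same Lie ring, with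
the scalar multiplication restricted along `F → E`. -/
abbrev Underlying (F : Type u) {E : Type v} [Field F] [Field E] [Algebra F E]
    (g : BundledLieAlgebra.{v, x} E) : Type x :=
  RestrictScalars F E g.carrier

end BundledLieAlgebra

/-- A bi-invariant complex structure on a real Lie algebra `h`: an `ℝ`-linear map `J : h → h` with
`J² = -1` and `[J X, Y] = J [X, Y]`. By antisymmetry also `[X, J Y] = J [X, Y]`, so such a `J` is
the same as a complex Lie algebra structure on `h` (with `i X = J X`) whose underlying real Lie
algebra is `h`. -/
structure BiinvariantComplexStructure (h : Type y) [LieRing h] [LieAlgebra ℝ h] where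
  J : h →ₗ[ℝ] h
  J_J : ∀ X : h, J (J X) = -X
  lie_J : ∀ X Y : h, ⁅J X, Y⁆ = J ⁅X, Y⁆

namespace BiinvariantComplexStructure

/-- Two bi-invariant complex structures on `h` are isomorphic if some automorphism of the real Lie
algebra `h` intertwines them, that is, is an isomorphism between the two complex Lie algebras. -/
def isoSetoid (h : Type y) [LieRing h] [LieAlgebra ℝ h] :
    Setoid (BiinvariantComplexStructure h) where
  r A B := ∃ e : h ≃ₗ⁅ℝ⁆ h, ∀ X : h, e (A.J X) = B.J (e X)
  iseqv :=
    { refl := fun _ => ⟨LieEquiv.refl, fun _ => rfl⟩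
      symm := fun {A B} ⟨e, he⟩ => ⟨e.symm, fun X => by
        apply e.injective
        have h1 := he (e.symm X)
        rw [LieEquiv.apply_symm_apply] at h1
        exact (LieEquiv.apply_symm_apply e (B.J X)).trans h1.symm⟩
      trans := fun ⟨e, he⟩ ⟨e', he'⟩ => ⟨e.trans e', fun X => by
        rw [LieEquiv.trans_apply, LieEquiv.trans_apply, he, he']⟩ }

end BiinvariantComplexStructure

open scoped TensorProduct

/-! If `g` restricts to `h`, separability of `E` over `F` splits the multiplication map from `E ⊗[F]
h` to `g`, and the splitting makes `g` a direct summand of `E ⊗[F] h` as a Lie algebra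
(`nonempty_of_restrictScalars`). So it suffices that a finite-dimensional `L` has finitely many
summands up to isomorphism. A summand is cut out by an idempotent of the centroid. Centroid elements
commute on brackets, so only finitely many idempotents arise on the span of brackets. That
restriction and the dimension determine the summand: what remains is central and is matched by
linear algebra (`nonempty_lieEquiv`). The real case is `ℂ` over `ℝ`. -/

/-- A set of pairwise commuting idempotents in a finite-dimensional algebra is finite. -/
theorem Set.finite_of_isIdempotentElem_of_commute {K A : Type*} [Field K] [Ring A] [Algebra K A]
    [FiniteDimensional K A] (s : Set A) (hid : ∀ a ∈ s, IsIdempotentElem a)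
    (hcomm : ∀ a ∈ s, ∀ b ∈ s, a * b = b * a) : s.Finite := by
  let R := Algebra.adjoin K s
  have hR : IsMulCommutative R := Algebra.isMulCommutative_adjoin K hcomm
  let _ : CommRing R := { (inferInstance : Ring R) with mul_comm := hR.is_comm.comm }
  have : IsArtinianRing R := isArtinian_of_tower K (inferInstance : IsArtinian K R)
  -- An idempotent is determined by its basic open set, and an Artinian ring has finite spectrum.
  have hfin : {e : R | IsIdempotentElem e}.Finite :=
    Set.Finite.of_finite_image (Set.toFinite (PrimeSpectrum.basicOpen '' _))
      PrimeSpectrum.basicOpen_injOn_isIdempotentElem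
  refine (hfin.image Subtype.val).subset fun a ha => ?_
  exact ⟨⟨a, Algebra.subset_adjoin ha⟩, Subtype.ext (hid a ha), rfl⟩

/-- A linear map between spaces of the same finite dimension which is injective on `D` and
surjective modulo `Z` becomes bijective after adding a map that kills `D` and takes values
in `Z`. -/
theorem LinearMap.exists_bijective_add {K V W : Type*} [Field K] [AddCommGroup V] [Module K V]
    [AddCommGroup W] [Module K W] [FiniteDimensional K V] [FiniteDimensional K W]
    (hdim : Module.finrank K V = Module.finrank K W) (T : V →ₗ[K] W)
    {D : Submodule K V} {Z : Submodule K W} (hD : Disjoint D (LinearMap.ker T))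
    (hZ : Codisjoint Z (LinearMap.range T)) :
    ∃ d : V →ₗ[K] W, (∀ x ∈ D, d x = 0) ∧ (∀ x, d x ∈ Z) ∧ Function.Bijective (T + d) := by
  obtain ⟨P, hDP, hP⟩ := hD.exists_isCompl
  obtain ⟨C, hCZ, hC⟩ := hZ.exists_isCompl
  -- By rank-nullity the kernel of `T` can be matched with a complement `C ≤ Z` of its range; `d`
  -- does so after projecting along `P ≥ D`.
  have hrank : Module.finrank K (LinearMap.ker T) = Module.finrank K C := by
    have h1 := T.finrank_range_add_finrank_ker
    have h2 := Submodule.finrank_add_eq_of_isCompl hC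
    omega
  let φ : LinearMap.ker T ≃ₗ[K] C := LinearEquiv.ofFinrankEq _ _ hrank
  let p := Submodule.projectionOnto (LinearMap.ker T) P hP.symm
  let d : V →ₗ[K] W := C.subtype ∘ₗ φ.toLinearMap ∘ₗ p
  have hd : ∀ x, d x = 0 → x ∈ P := fun x hx => by
    have : p x = 0 := φ.injective (Subtype.ext (by simpa [d] using hx))
    exact (Submodule.projectionOnto_apply_eq_zero_iff hP.symm).1 this
  refine ⟨d, fun x hx => ?_, fun x => hCZ (φ (p x)).2, ?_⟩
  · have : p x = 0 := (Submodule.projectionOnto_apply_eq_zero_iff hP.symm).2 (hDP hx)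
    simp [d, this]
  · have hinj : Function.Injective (T + d) := by
      refine (injective_iff_map_eq_zero _).2 fun x hx => ?_
      have hTd : T x = -d x := eq_neg_of_add_eq_zero_left hx
      have hdC : d x ∈ C := (φ (p x)).2
      have hT : T x = 0 := Submodule.disjoint_def.1 hC.disjoint _
        (hTd ▸ C.neg_mem hdC)
        (LinearMap.mem_range_self T x)
      have hdx : d x = 0 := by simpa [hT] using hTd
      exact Submodule.disjoint_def.1 hP.disjoint _ (hd x hdx) hT
    exact ⟨hinj, (LinearMap.injective_iff_surjective_of_finrank_eq_finrank hdim).1 hinj⟩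

/-! ### Summands and idempotents of the centroid -/

/-- `g` is a retract of the Lie algebra `L` via a Lie homomorphism `L → g` and a linear section
whose composition lies in the centroid of `L`: up to isomorphism, a direct summand of `L`. -/
structure LieSummand (E : Type*) [Field E] (L : Type*) [LieRing L] [LieAlgebra E L]
    (g : Type*) [LieRing g] [LieAlgebra E g] where
  proj : L →ₗ⁅E⁆ g
  incl : g →ₗ[E] L
  proj_incl : ∀ x, proj (incl x) = x
  incl_proj_lie : ∀ x y, incl (proj ⁅x, y⁆) = ⁅incl (proj x), y⁆

namespace LieSummand

variable {E : Type*} [Field E] {L : Type*} [LieRing L] [LieAlgebra E L]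
  {g : Type*} [LieRing g] [LieAlgebra E g] {g' : Type*} [LieRing g'] [LieAlgebra E g']

theorem incl_injective (s : LieSummand E L g) : Function.Injective s.incl :=
  Function.LeftInverse.injective s.proj_incl

theorem incl_lie (s : LieSummand E L g) (x y : g) : s.incl ⁅x, y⁆ = ⁅s.incl x, s.incl y⁆ := by
  have h := s.incl_proj_lie (s.incl x) (s.incl y)
  rwa [LieHom.map_lie, s.proj_incl, s.proj_incl] at h

/-- The idempotent of the centroid that cuts out a summand. -/
def idem (s : LieSummand E L g) : L →ₗ[E] L := s.incl ∘ₗ s.proj.toLinearMap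

theorem idem_apply (s : LieSummand E L g) (x : L) : s.idem x = s.incl (s.proj x) := rfl

theorem idem_idem (s : LieSummand E L g) (x : L) : s.idem (s.idem x) = s.idem x := by
  simp only [idem_apply, s.proj_incl]

theorem idem_lie (s : LieSummand E L g) (x y : L) : s.idem ⁅x, y⁆ = ⁅s.idem x, y⁆ :=
  s.incl_proj_lie x y

theorem idem_lie' (s : LieSummand E L g) (x y : L) : s.idem ⁅x, y⁆ = ⁅x, s.idem y⁆ := by
  rw [← lie_skew, map_neg, idem_lie, lie_skew]

variable (E L) in
/-- The span of all brackets. -/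
def brackets : Submodule E L := Submodule.span E {z | ∃ x y : L, ⁅x, y⁆ = z}

theorem lie_mem_brackets (x y : L) : ⁅x, y⁆ ∈ brackets E L :=
  Submodule.subset_span ⟨x, y, rfl⟩

theorem brackets_induction {p : L → Prop} (h : ∀ x y : L, p ⁅x, y⁆) (h0 : p 0)
    (hadd : ∀ x y, p x → p y → p (x + y)) (hsmul : ∀ (a : E) x, p x → p (a • x)) {z : L}
    (hz : z ∈ brackets E L) : p z := by
  induction hz using Submodule.span_induction with
  | mem z hz => obtain ⟨x, y, rfl⟩ := hz; exact h x y
  | zero => exact h0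
  | add x y _ _ hx hy => exact hadd x y hx hy
  | smul a x _ hx => exact hsmul a x hx

theorem idem_mem_brackets (s : LieSummand E L g) {z : L} (hz : z ∈ brackets E L) :
    s.idem z ∈ brackets E L := by
  refine brackets_induction (E := E) (p := fun z => s.idem z ∈ brackets E L) ?_ ?_ ?_ ?_ hz
  · intro x y
    rw [idem_lie]
    exact lie_mem_brackets _ _
  · simp
  · intro x y hx hy
    rw [map_add]
    exact add_mem hx hy
  · intro a x hx
    rw [map_smul]
    exact Submodule.smul_mem _ a hx

/-- On a bracket, one idempotent can be moved into the left slot and the other into the right, so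
both orders give `⁅s'.idem x, s.idem y⁆`. -/
theorem idem_comm (s : LieSummand E L g) (s' : LieSummand E L g') {z : L}
    (hz : z ∈ brackets E L) : s.idem (s'.idem z) = s'.idem (s.idem z) := by
  refine brackets_induction (E := E)
    (p := fun z => s.idem (s'.idem z) = s'.idem (s.idem z)) ?_ ?_ ?_ ?_ hz
  · intro x y
    rw [s'.idem_lie, s.idem_lie', s.idem_lie', s'.idem_lie]
  · simp
  · intro x y hx hy
    simp only [map_add, hx, hy]
  · intro a x hx
    simp only [map_smul, hx]

/-- The idempotent of a summand, acting on the span of the brackets. -/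
def derivedIdem (s : LieSummand E L g) : Module.End E (brackets E L) :=
  s.idem.restrict fun _ => s.idem_mem_brackets

variable [FiniteDimensional E L]

theorem finiteDimensional (s : LieSummand E L g) : FiniteDimensional E g :=
  FiniteDimensional.of_injective s.incl s.incl_injective

/-- Summands of the same dimension whose idempotents agree on brackets are isomorphic. -/
theorem nonempty_lieEquiv (s : LieSummand E L g) (s' : LieSummand E L g')
    (hdim : Module.finrank E g = Module.finrank E g') (h : s.derivedIdem = s'.derivedIdem) :
    Nonempty (g ≃ₗ⁅E⁆ g') := by
  have := s.finiteDimensional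
  have := s'.finiteDimensional
  have hidem : ∀ x y : L, s.idem ⁅x, y⁆ = s'.idem ⁅x, y⁆ := fun x y =>
    congrArg Subtype.val (LinearMap.congr_fun h ⟨⁅x, y⁆, lie_mem_brackets x y⟩)
  -- `T` is a Lie homomorphism, but may fail to be bijective on central parts.
  let T : g →ₗ[E] g' := s'.proj.toLinearMap ∘ₗ s.incl
  have hT : ∀ x, T x = s'.proj (s.incl x) := fun _ => rfl
  have hTlie : ∀ x y, T ⁅x, y⁆ = ⁅T x, T y⁆ := fun x y => by
    rw [hT, s.incl_lie, LieHom.map_lie, hT, hT]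
  have hTinj : ∀ z ∈ brackets E g, s'.incl (T z) = s.incl z := fun z hz => by
    refine brackets_induction (E := E) (p := fun z => s'.incl (T z) = s.incl z) ?_ ?_ ?_ ?_ hz
    · intro x y
      rw [hT, s.incl_lie, ← s'.idem_apply, ← hidem, ← s.incl_lie, s.idem_apply, s.proj_incl]
    · simp
    · intro x y hx hy
      simp only [map_add, hx, hy]
    · intro a x hx
      simp only [map_smul, hx]
  let Z : Submodule E g' := (LieAlgebra.center E g').toSubmodule
  have hker : Disjoint (brackets E g) (LinearMap.ker T) := by
    refine Submodule.disjoint_def.2 fun z hz hz0 => s.incl_injective ?_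
    rw [← hTinj z hz, LinearMap.mem_ker.1 hz0, map_zero, map_zero]
  have hrange : Codisjoint Z (LinearMap.range T) := by
    refine codisjoint_iff.2 (eq_top_iff.2 fun x _ => ?_)
    have hx : x = (x - T (s.proj (s'.incl x))) + T (s.proj (s'.incl x)) := by abel
    rw [hx]
    refine Submodule.add_mem_sup ?_ (LinearMap.mem_range_self _ _)
    refine (LieModule.mem_maxTrivSubmodule (R := E) (L := g') (M := g') _).2 fun y => ?_
    have key : ⁅y, T (s.proj (s'.incl x))⁆ = ⁅y, x⁆ := by
      conv_lhs => rw [← s'.proj_incl y, hT, ← LieHom.map_lie, ← s.idem_apply, ← s.idem_lie']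
      rw [hidem, ← s'.incl_lie, s'.idem_apply, s'.proj_incl, s'.proj_incl]
    rw [lie_sub, key, sub_self]
  obtain ⟨d, hdD, hdZ, hbij⟩ := T.exists_bijective_add hdim hker hrange
  have hd1 : ∀ x y, ⁅y, d x⁆ = 0 := fun x y =>
    (LieModule.mem_maxTrivSubmodule (R := E) (L := g') (M := g') _).1 (hdZ x) y
  have hd2 : ∀ (x : g) (y : g'), ⁅d x, y⁆ = 0 := fun x y => by rw [← lie_skew, hd1, neg_zero]
  -- The correction `d` vanishes on brackets and has central values, so the bracket is still
  -- preserved.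
  let f : g →ₗ⁅E⁆ g' :=
    { T + d with
      map_lie' := fun {x y} => by
        change T ⁅x, y⁆ + d ⁅x, y⁆ = ⁅T x + d x, T y + d y⁆
        rw [hdD _ (lie_mem_brackets x y), hTlie, add_lie, lie_add, lie_add, hd1, hd2, hd2]
        simp }
  exact ⟨LieEquiv.ofBijective f hbij⟩

/-- There are only finitely many isomorphism classes of summands. -/
theorem finite_isoClass {E : Type v} [Field E] (L : Type*) [LieRing L] [LieAlgebra E L]
    [FiniteDimensional E L] :
    {c : BundledLieAlgebra.IsoClass.{v, x} E |
      ∃ g : BundledLieAlgebra.{v, x} E, g.isoClass = c ∧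
        Nonempty (LieSummand E L g.carrier)}.Finite := by
  classical
  let S : Set (Module.End E (brackets E L)) :=
    {p | ∃ (g : BundledLieAlgebra.{v, x} E) (s : LieSummand E L g.carrier), s.derivedIdem = p}
  have hS : S.Finite := by
    refine Set.finite_of_isIdempotentElem_of_commute (K := E) S ?_ ?_
    · rintro _ ⟨g, s, rfl⟩
      exact LinearMap.ext fun z => Subtype.ext (s.idem_idem z)
    · rintro _ ⟨g, s, rfl⟩ _ ⟨g', s', rfl⟩
      exact LinearMap.ext fun z => Subtype.ext (s.idem_comm s' z.2)
  let C := {c : BundledLieAlgebra.IsoClass.{v, x} E |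
      ∃ g : BundledLieAlgebra.{v, x} E, g.isoClass = c ∧ Nonempty (LieSummand E L g.carrier)}
  choose G hG hs using fun c : C => c.2
  let s : ∀ c : C, LieSummand E L (G c).carrier := fun c => (hs c).some
  let f : C → S × Fin (Module.finrank E L + 1) := fun c =>
    (⟨(s c).derivedIdem, G c, s c, rfl⟩,
      ⟨Module.finrank E (G c).carrier,
        Nat.lt_succ_of_le (LinearMap.finrank_le_finrank_of_injective (s c).incl_injective)⟩)
  have := hS.to_subtype
  refine Set.finite_coe_iff.1 (Finite.of_injective f fun c c' hcc => Subtype.ext ?_)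
  obtain ⟨h1, h2⟩ := Prod.ext_iff.1 hcc
  rw [← hG c, ← hG c']
  exact Quotient.sound ((s c).nonempty_lieEquiv (s c') (congrArg Fin.val h2)
    (congrArg Subtype.val h1))

/-- A Lie algebra over a separable extension `E` of `F` is a summand of the extension of scalars of
its restriction of scalars. -/
theorem nonempty_of_restrictScalars {F E M h : Type*} [Field F] [Field E] [Algebra F E]
    [FiniteDimensional F E] [Algebra.IsSeparable F E] [LieRing M] [LieAlgebra F M]
    [LieAlgebra E M] [IsScalarTower F E M] [LieRing h] [LieAlgebra F h] (e : M ≃ₗ⁅F⁆ h) :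
    Nonempty (LieSummand E (E ⊗[F] h) M) := by
  have : Algebra.FormallyUnramified F E := Algebra.FormallyUnramified.of_isSeparable F E
  let act : M →ₗ[F] E →ₗ[F] M := (Algebra.lsmul F F M : E →ₐ[F] Module.End F M).toLinearMap.flip
  let p : E ⊗[F] h →ₗ[E] M := TensorProduct.AlgebraTensorModule.lift
    ((LinearMap.lsmul E (h →ₗ[F] M)).flip e.symm.toLinearEquiv.toLinearMap)
  have hp : ∀ (a : E) (x : h), p (a ⊗ₜ x) = a • e.symm x := fun a x => rfl
  let ψ : E ⊗[F] M →ₗ[E] E ⊗[F] h :=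
    TensorProduct.AlgebraTensorModule.map LinearMap.id e.toLinearEquiv.toLinearMap
  have hψ : ∀ (a : E) (x : M), ψ (a ⊗ₜ x) = a ⊗ₜ e x := fun a x => rfl
  let i : M →ₗ[E] E ⊗[F] h := ψ ∘ₗ Algebra.FormallyUnramified.sec F E M
  -- `i` is the case where `t` is the separability element; a general `t` allows induction on
  -- tensors.
  let w (t : E ⊗[F] E) (m : M) : E ⊗[F] h :=
    ψ (TensorProduct.AlgebraTensorModule.map (LinearMap.id (R := E) (M := E)) (act m) t)
  have hw : ∀ (a b : E) (m : M), w (a ⊗ₜ b) m = a ⊗ₜ e (b • m) := fun a b m => rfl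
  have hiw : ∀ m, i m = w (Algebra.FormallyUnramified.elem F E) m := fun m => rfl
  have hwlie : ∀ t m (b : E) (y : h), ⁅w t m, b ⊗ₜ[F] y⁆ = b • w t ⁅m, e.symm y⁆ := by
    intro t m b y
    induction t using TensorProduct.induction_on with
    | zero => simp [w]
    | tmul a c =>
      rw [hw, hw, LieAlgebra.ExtendScalars.bracket_tmul, TensorProduct.smul_tmul', ← smul_lie,
        LieEquiv.map_lie, LieEquiv.apply_symm_apply, smul_eq_mul, mul_comm]
    | add t u ht hu =>
      have hadd : ∀ n, w (t + u) n = w t n + w u n := fun n => by simp [w]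
      rw [hadd, hadd, add_lie, ht, hu, smul_add]
  have hplie : ∀ x y : E ⊗[F] h, p ⁅x, y⁆ = ⁅p x, p y⁆ := by
    intro x y
    induction x using TensorProduct.induction_on with
    | zero => simp
    | tmul a x =>
      induction y using TensorProduct.induction_on with
      | zero => simp
      | tmul b y =>
        rw [LieAlgebra.ExtendScalars.bracket_tmul, hp, hp, hp, LieEquiv.map_lie, smul_lie,
          lie_smul, smul_smul]
      | add y z hy hz => rw [lie_add, map_add, hy, hz, map_add, lie_add]
    | add x z hx hz => rw [add_lie, map_add, hx, hz, map_add, add_lie]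
  refine ⟨⟨{ p with map_lie' := fun {x y} => hplie x y }, i, fun m => ?_, fun x y => ?_⟩⟩
  · have hpψ : ∀ z : E ⊗[F] M, p (ψ z) = TensorProduct.AlgebraTensorModule.lift
        ((LinearMap.lsmul E (M →ₗ[F] M)).flip LinearMap.id) z := by
      intro z
      induction z using TensorProduct.induction_on with
      | zero => simp
      | tmul a x => rw [hψ, hp, LieEquiv.symm_apply_apply]; rfl
      | add x y hx hy => rw [map_add, map_add, hx, hy, map_add]
    have := LinearMap.congr_fun (Algebra.FormallyUnramified.comp_sec F E M) m
    exact (hpψ _).trans this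
  · change i (p ⁅x, y⁆) = ⁅i (p x), y⁆
    rw [hplie]
    induction y using TensorProduct.induction_on with
    | zero => simp
    | tmul b y => rw [hp, lie_smul, map_smul, hiw, hiw, hwlie]
    | add y z hy hz => rw [map_add, lie_add, map_add, hy, hz, lie_add]

end LieSummand

namespace BundledLieAlgebra

/-- Finiteness of the `E`-forms of a Lie algebra over `F`, for `E` finite separable over `F`. -/
theorem finite_isoClass_of_isSeparable (F : Type u) (E : Type v) [Field F] [Field E] [Algebra F E]
    [FiniteDimensional F E] [Algebra.IsSeparable F E]
    (h : Type w) [LieRing h] [LieAlgebra F h] [FiniteDimensional F h] :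
    {c : IsoClass.{v, x} E |
      ∃ g : BundledLieAlgebra.{v, x} E,
        g.isoClass = c ∧ Nonempty (g.Underlying F ≃ₗ⁅F⁆ h)}.Finite := by
  refine (LieSummand.finite_isoClass (E := E) (E ⊗[F] h)).subset ?_
  rintro c ⟨g, hg, ⟨e⟩⟩
  refine ⟨g, hg, ?_⟩
  -- The type synonym forgets the `E`-structure, which is put back here.
  let _ : LieAlgebra E (g.Underlying F) := inferInstanceAs (LieAlgebra E g.carrier)
  have : IsScalarTower F E (g.Underlying F) := RestrictScalars.isScalarTower F E g.carrier
  exact LieSummand.nonempty_of_restrictScalars (M := g.Underlying F) e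

end BundledLieAlgebra

/-! ### Complex structures as complex Lie algebras -/

namespace BiinvariantComplexStructure

variable {h : Type y} [LieRing h] [LieAlgebra ℝ h]

/-- The complex structure as an action of `ℂ`. -/
def action (A : BiinvariantComplexStructure h) : ℂ →ₐ[ℝ] Module.End ℝ h :=
  Complex.lift ⟨A.J, LinearMap.ext A.J_J⟩

theorem action_apply (A : BiinvariantComplexStructure h) (z : ℂ) (X : h) :
    A.action z X = z.re • X + z.im • A.J X := by
  simp [action, Complex.liftAux_apply, Module.algebraMap_end_apply]

/-- The complex Lie algebra given by a bi-invariant complex structure. -/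
def toBundledLieAlgebra (A : BiinvariantComplexStructure h) : BundledLieAlgebra.{0, y} ℂ :=
  letI : Module ℂ h := Module.compHom h A.action.toRingHom
  have hsmul : ∀ (z : ℂ) (X : h), z • X = z.re • X + z.im • A.J X := A.action_apply
  have hlie : ∀ X Y : h, ⁅X, A.J Y⁆ = A.J ⁅X, Y⁆ := fun X Y => by
    rw [← lie_skew, A.lie_J, ← map_neg, lie_skew]
  letI : LieAlgebra ℂ h :=
    { lie_smul := fun z X Y => by simp only [hsmul, lie_add, lie_smul, hlie] }
  ⟨h⟩

theorem smul_toBundledLieAlgebra (A : BiinvariantComplexStructure h) (z : ℂ) (X : h) :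
    (z • (show A.toBundledLieAlgebra.carrier from X) : A.toBundledLieAlgebra.carrier) =
      z.re • X + z.im • A.J X :=
  A.action_apply z X

theorem nonempty_underlying_lieEquiv (A : BiinvariantComplexStructure h) :
    Nonempty (A.toBundledLieAlgebra.Underlying ℝ ≃ₗ⁅ℝ⁆ h) := by
  refine ⟨{ toFun := fun X => X, invFun := fun X => X, map_add' := fun _ _ => rfl,
            map_smul' := fun r X => ?_, map_lie' := rfl, left_inv := fun _ => rfl,
            right_inv := fun _ => rfl }⟩
  refine (A.smul_toBundledLieAlgebra (r : ℂ) X).trans ?_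
  change (r : ℂ).re • (id X : h) + (r : ℂ).im • A.J X = r • (id X : h)
  simp

theorem rel_of_lieEquiv {A B : BiinvariantComplexStructure h}
    (e : A.toBundledLieAlgebra.carrier ≃ₗ⁅ℂ⁆ B.toBundledLieAlgebra.carrier) :
    isoSetoid h A B := by
  let f : h → h := fun X => e X
  have key : ∀ (z : ℂ) (X : h), f (z.re • X + z.im • A.J X) = z.re • f X + z.im • B.J (f X) :=
    fun z X => by
      rw [← A.smul_toBundledLieAlgebra, ← B.smul_toBundledLieAlgebra]
      exact e.toLinearEquiv.map_smul z X
  refine ⟨{ toFun := f, invFun := fun X => e.symm X, map_add' := fun X Y => ?_,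
            map_smul' := fun r X => ?_, map_lie' := fun {X Y} => ?_,
            left_inv := fun X => e.symm_apply_apply X,
            right_inv := fun X => e.apply_symm_apply X }, fun X => ?_⟩
  · exact e.toLinearEquiv.map_add X Y
  · simpa using key (r : ℂ) X
  · exact e.map_lie X Y
  · have hI : f (A.J X) = B.J (f X) := by simpa using key Complex.I X
    exact hI

theorem finite_quotient (h : Type y) [LieRing h] [LieAlgebra ℝ h] [FiniteDimensional ℝ h] :
    Finite (Quotient (isoSetoid h)) := by
  have hfin := BundledLieAlgebra.finite_isoClass_of_isSeparable.{0, 0, y, y} ℝ ℂ h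
  have := hfin.to_subtype
  -- Sending a structure to the class of its complex Lie algebra is injective by `rel_of_lieEquiv`.
  refine Finite.of_injective
    (fun q : Quotient (isoSetoid h) => (⟨q.out.toBundledLieAlgebra.isoClass,
      q.out.toBundledLieAlgebra, rfl, q.out.nonempty_underlying_lieEquiv⟩ :
      {c : BundledLieAlgebra.IsoClass.{0, y} ℂ | ∃ g : BundledLieAlgebra.{0, y} ℂ,
        g.isoClass = c ∧ Nonempty (g.Underlying ℝ ≃ₗ⁅ℝ⁆ h)})) fun q q' hq => ?_
  obtain ⟨e⟩ := Quotient.exact (congrArg Subtype.val hq)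
  rw [← q.out_eq, ← q'.out_eq]
  exact Quotient.sound (rel_of_lieEquiv e)

end BiinvariantComplexStructure

theorem mainTheorem7 :
    (∀ (F : Type u) (E : Type v) [Field F] [Field E] [Algebra F E]
        [FiniteDimensional F E] [IsGalois F E]
        (h : Type w) [LieRing h] [LieAlgebra F h] [FiniteDimensional F h],
      {c : BundledLieAlgebra.IsoClass.{v, x} E |
        ∃ g : BundledLieAlgebra.{v, x} E,
          g.isoClass = c ∧ Nonempty (g.Underlying F ≃ₗ⁅F⁆ h)}.Finite) ∧
    (∀ (h : Type y) [LieRing h] [LieAlgebra ℝ h] [FiniteDimensional ℝ h],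
      Finite (Quotient (BiinvariantComplexStructure.isoSetoid h))) :=
  ⟨fun F E _ _ _ _ _ h _ _ _ => BundledLieAlgebra.finite_isoClass_of_isSeparable F E h,
    fun h _ _ _ => BiinvariantComplexStructure.finite_quotient h⟩
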